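/- Identify $P(\mathbb N)$ with the Cantor space $\{0,1\}^{\mathbb N}$ (product topology) via characteristic functions, let $\mathrm{Fin}\subseteq P(\mathbb N)$ be the collection of finite subsets of $\mathbb N$, and give subsets of $P(\mathbb N)$ the subspace topology. A cover of a space $X$ is a family $\mathcal U$ of subsets of $X$ with $\bigcup\mathcal U=X$ and $X\notin\mathcal U$. A cover $\mathcal U$ of $X$ is: - an $n$-cover if every subset of $X$ with at most $n$ elements is contained in a member of $\mathcal U$; - a $\gamma$-cover if $\mathcal U$ is infinite and each $x\in X$ belongs to all but finitely many members of $\mathcal U$; - a $\tau$-cover if each $x\in X$ belongs to infinitely many members of $\mathcal U$, and for all $x,y\in X$ at least one of $\{U\in\mathcal U: x\in U,\ y\notin U\}$ and $\{U\in\mathcal U: y\in U,\ x\notin U\}$ is finite. A space $X$ is a strong $\gamma$-set if for every sequence $(\mathcal U_n)_{n\in\mathbb N}$, where $\mathcal U_n$ is an open $n$-cover of $X$, there are $U_n\in\mathcal U_n$ such that $\{U_n:n\in\mathbb N\}$ is a $\gamma$-cover of $X$ and each $x\in X$ belongs to $U_n$ for all but finitely many $n$. A space $X$ is a $\tau$-set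 if each $\tau$-cover of $X$ by clopen sets contains a $\gamma$-cover of $X$. A space $X$ satisfies $\mathsf U_{fin}(\Gamma,\mathcal O)$ if for every sequence $(\mathcal U_n)_{n\in\mathbb N}$ of countable open $\gamma$-covers of $X$, none of which contains a finite subcover, there are finite (possibly empty) $\mathcal F_n\subseteq\mathcal U_n$ such that $\{\bigcup\mathcal F_n:n\in\mathbb N\}$ is a cover of $X$. **Theorem.** Assume Martin's Axiom (for every nonempty preordered set with the countable chain condition and every family of fewer than $2^{\aleph_0}$ dense subsets, there is a filter meeting all of them). Then there exists $X\subseteq P(\mathbb N)$ such that $X$ is a strong $\gamma$-set, but $X\setminus\mathrm{Fin}$ does not satisfy $\mathsf U_{fin}(\Gamma,\mathcal O)$ and is not a $\tau$-set. -/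

import Mathlib

open Cardinal Filter

namespace SelPrin

/-- The countable chain condition: every set of pairwise
incompatible elements is countable, where `p`, `q` are compatible when some `r` satisfies
`r ≤ p` and `r ≤ q`. -/
def CCC (P : Type*) [Preorder P] : Prop :=
  ∀ A : Set P, (A.Pairwise fun p q => ¬ ∃ r, r ≤ p ∧ r ≤ q) → A.Countable

/-- `D` is dense in `P`: below every element of `P` there is an element of `D`. -/
def IsDenseIn {P : Type*} [Preorder P] (D : Set P) : Prop :=
  ∀ p : P, ∃ d ∈ D, d ≤ p

/-- Martin's Axiom: for every nonempty ccc preorder and every family of fewer than continuum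
many dense subsets, there is a filter (nonempty, upward closed, downward directed) meeting
all of them. -/
def MartinsAxiom : Prop :=
  ∀ (P : Type) [Preorder P] [Nonempty P], CCC P →
    ∀ 𝒟 : Set (Set P), #𝒟 < 𝔠 → (∀ D ∈ 𝒟, IsDenseIn D) →
      ∃ G : Order.PFilter P, ∀ D ∈ 𝒟, ∃ p ∈ D, p ∈ G

section Covers

variable {X : Type*}

/-- A cover of the space `X`, none of whose members contains all of `X`. -/
def IsCover (𝒰 : Set (Set X)) : Prop :=
  ⋃₀ 𝒰 = Set.univ ∧ Set.univ ∉ 𝒰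

/-- A cover such that every subset of `X` with at most `n` elements is contained in a member. -/
def IsNCover (n : ℕ) (𝒰 : Set (Set X)) : Prop :=
  IsCover 𝒰 ∧ ∀ F : Finset X, F.card ≤ n → ∃ U ∈ 𝒰, (F : Set X) ⊆ U

/-- A `τ`-cover: each point lies in infinitely many members, and for all points `x`, `y`, the
members containing `x` but not `y` are finitely many, or vice versa. -/
def IsTauCover (𝒰 : Set (Set X)) : Prop :=
  IsCover 𝒰 ∧ (∀ x, {U ∈ 𝒰 | x ∈ U}.Infinite) ∧
    ∀ x y, {U ∈ 𝒰 | x ∈ U ∧ y ∉ U}.Finite ∨ {U ∈ 𝒰 | y ∈ U ∧ x ∉ U}.Finite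

/-- A `γ`-cover: infinite, and each point belongs to all but finitely many members. -/
def IsGammaCover (𝒰 : Set (Set X)) : Prop :=
  IsCover 𝒰 ∧ 𝒰.Infinite ∧ ∀ x, {U ∈ 𝒰 | x ∉ U}.Finite

/-- The selection principle `Ufin(𝒜, ℬ)`. -/
def Ufin (𝒜 ℬ : Set (Set (Set X))) : Prop :=
  ∀ 𝒰 : ℕ → Set (Set X), (∀ n, 𝒰 n ∈ 𝒜) →
    (∀ n, ∀ ℱ ⊆ 𝒰 n, ℱ.Finite → ⋃₀ ℱ ≠ Set.univ) →
    ∃ ℱ : ℕ → Set (Set X), (∀ n, ℱ n ⊆ 𝒰 n ∧ (ℱ n).Finite) ∧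
      Set.range (fun n => ⋃₀ ℱ n) ∈ ℬ

end Covers

section Spaces

variable (X : Type*) [TopologicalSpace X]

/-- The collection `O` of countable open covers of `X`. -/
def OpenCovers : Set (Set (Set X)) :=
  {𝒰 | 𝒰.Countable ∧ (∀ U ∈ 𝒰, IsOpen U) ∧ IsCover 𝒰}

/-- The collection `Γ` of countable open `γ`-covers of `X`. -/
def GammaCovers : Set (Set (Set X)) :=
  {𝒰 | 𝒰.Countable ∧ (∀ U ∈ 𝒰, IsOpen U) ∧ IsGammaCover 𝒰}

/-- A strong `γ`-set: from each sequence of open `n`-covers, `n ∈ ℕ`, one can select one member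
each so that the selected sets form a `γ`-cover; moreover each point lies in `U n` for all but
finitely many indices `n` (so the sequence, not only its range, is a `γ`-cover). -/
def IsStrongGammaSet : Prop :=
  ∀ 𝒰 : ℕ → Set (Set X), (∀ n, (∀ U ∈ 𝒰 n, IsOpen U) ∧ IsNCover n (𝒰 n)) →
    ∃ U : ℕ → Set X, (∀ n, U n ∈ 𝒰 n) ∧ IsGammaCover (Set.range U) ∧
      ∀ x, ∀ᶠ n in atTop, x ∈ U n

/-- A `τ`-set: each clopen `τ`-cover contains a `γ`-cover. -/
def IsTauSet : Prop :=
  ∀ 𝒰 : Set (Set X), (∀ U ∈ 𝒰, IsClopen U) → IsTauCover 𝒰 →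
    ∃ 𝒱 ⊆ 𝒰, IsGammaCover 𝒱

end Spaces

/-- `Fin`, the collection of finite sets of natural numbers, as a subset of the Cantor space
`ℕ → Bool`, which is identified with `P(ℕ)` by characteristic functions. -/
def FinSets : Set (ℕ → Bool) := {x | {n | x n = true}.Finite}

end SelPrin

/-!
Subsets of `ℕ` are points of the Cantor space. Under Martin's Axiom there is a family `Y` of
infinite sets, linearly ordered by almost inclusion, such that

* `Y` contains sets of every degree of sparseness: for each `g : ℕ → ℕ` there is `z ∈ Y` with at
  most `n` elements below `g n`, for all `n`;
* whenever each `V n` is a family of clopen sets that contains a superset of every set of at most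
  `n` points of `Y ∪ Fin`, one can select `C n ∈ V n` such that each point of `Y ∪ Fin` belongs to
  `C n` for all but finitely many `n`.

The family (`MartinsAxiom.exists_tower`) is built by recursion over all pairs `(V, g)`, in an
ordering all of whose proper initial segments have size less than the continuum; this is possible
because there are only countably many clopen sets. At a given step, let `T` be the set of points
found so far. Martin's Axiom is applied to finite approximations (`Approx`) of a selection
`C n ∈ V n` together with an infinite set almost contained in all members of `T`, such that not
only each point of `T`, but *every* set almost contained in the new one, belongs to `C n` for all
but finitely many `n` (`MartinsAxiom.exists_pseudointersection`). All points added later, and all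
finite sets, are thereby dealt with at once. To achieve this, a newly chosen `C n` must contain
every subset of a slowly growing finite set, and the elements added to the infinite set afterwards
must lie beyond the coordinates on which `C n` depends. Finally, the new set is thinned out so as
to be sparse with respect to `g`.

Put `X = Y ∪ Fin`, so that `X \ Fin = Y`. Open covers are refined by clopen sets, so `X` is a
strong `γ`-set (`isStrongGammaSet_of_clopen`). Sparseness says that `Y` is dominating, so `Y` is not
a Menger space (`not_ufin_of_sparse`), and that `Y` has no pseudointersection. Hence the sets
`{x ∈ Y | n ∈ x}`, which form a `τ`-cover because `Y` is linearly ordered by almost inclusion, do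
not include a `γ`-cover (`not_isTauSet_of_sparse`).
-/

namespace SelPrin

/-! ### Clopen subsets of the Cantor space -/

/-- A code `⟨K, S⟩` for the clopen subset of the Cantor space consisting of the points whose
restriction to the first `K` coordinates belongs to `S`. There are only countably many codes. -/
abbrev ClopenCode : Type := Σ K : ℕ, Finset (Fin K → Bool)

namespace ClopenCode

/-- The clopen set described by a code. -/
def toSet (C : ClopenCode) : Set (ℕ → Bool) := {x | (fun i : Fin C.1 => x i) ∈ C.2}

theorem mem_toSet_congr (C : ClopenCode) {x y : ℕ → Bool} (h : ∀ i < C.1, x i = y i) :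
    x ∈ C.toSet ↔ y ∈ C.toSet := by
  have : (fun i : Fin C.1 => x i) = fun i : Fin C.1 => y i := funext fun i => h i i.2
  simp only [toSet, Set.mem_ofPred_eq, this]

/-- Finite sets and open supersets are separated by clopen sets. -/
theorem exists_between {F : Finset (ℕ → Bool)} {O : Set (ℕ → Bool)} (hO : IsOpen O)
    (hF : (F : Set (ℕ → Bool)) ⊆ O) :
    ∃ C : ClopenCode, (F : Set (ℕ → Bool)) ⊆ C.toSet ∧ C.toSet ⊆ O := by
  classical
  have hcyl : ∀ x ∈ F, ∃ n, ∀ y : ℕ → Bool, (∀ i < n, y i = x i) → y ∈ O := by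
    intro x hx
    obtain ⟨_, ⟨z, n, rfl⟩, hxz, hzO⟩ :=
      (PiNat.isTopologicalBasis_cylinders (fun _ : ℕ => Bool)).exists_subset_of_mem_open
        (hF hx) hO
    refine ⟨n, fun y hy => hzO ?_⟩
    rw [PiNat.mem_cylinder_iff] at hxz ⊢
    exact fun i hi => (hy i hi).trans (hxz i hi)
  choose! k hk using hcyl
  refine ⟨⟨F.sup k, F.image fun (x : ℕ → Bool) (i : Fin (F.sup k)) => x i⟩,
    fun x hx => ?_, fun y hy => ?_⟩
  · simpa [toSet] using ⟨x, hx, rfl⟩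
  · obtain ⟨x, hx, hxy⟩ := Finset.mem_image.1 hy
    refine hk x hx y fun i hi => ?_
    exact (congrFun hxy ⟨i, hi.trans_le (Finset.le_sup (f := k) hx)⟩).symm

end ClopenCode

/-- The sequence `V` of families of clopen sets is `n`-covering for `Y` at every index `n`: each
set of at most `n` points of `Y` is contained in a member of `V n`. -/
def IsNCovering (V : ℕ → Set ClopenCode) (Y : Set (ℕ → Bool)) : Prop :=
  ∀ n, ∀ H : Finset (ℕ → Bool), (H : Set (ℕ → Bool)) ⊆ Y → H.card ≤ n →
    ∃ C ∈ V n, (H : Set (ℕ → Bool)) ⊆ C.toSet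

/-- `x ⊆* y`: all but finitely many elements of `x` belong to `y`. -/
def AlmostSubset (x y : ℕ → Bool) : Prop := {n | x n = true ∧ y n = false}.Finite

theorem AlmostSubset.refl (x : ℕ → Bool) : AlmostSubset x x := by
  simp [AlmostSubset]

theorem AlmostSubset.trans {x y z : ℕ → Bool} (hxy : AlmostSubset x y) (hyz : AlmostSubset y z) :
    AlmostSubset x z := by
  refine (Set.Finite.union hxy hyz).subset fun n hn => ?_
  by_cases h : y n = true
  · exact Or.inr ⟨h, hn.2⟩
  · exact Or.inl ⟨hn.1, by simpa using h⟩

theorem AlmostSubset.infinite_inter {x y : ℕ → Bool} (hxy : AlmostSubset x y)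
    (hx : {n | x n = true}.Infinite) : {n | x n = true ∧ y n = true}.Infinite := by
  refine fun hfin => hx ((hfin.union hxy).subset fun n hn => ?_)
  by_cases h : y n = true
  · exact Or.inl ⟨hn, h⟩
  · exact Or.inr ⟨hn, by simpa using h⟩

/-! ### The forcing notion -/

/-- The points of the Cantor space supported on the finite set `b`. -/
noncomputable def pointsBelow (b : Finset ℕ) : Finset (ℕ → Bool) :=
  open Classical in b.powerset.image fun s i => decide (i ∈ s)

theorem mem_pointsBelow {b : Finset ℕ} {y : ℕ → Bool} :
    y ∈ pointsBelow b ↔ ∀ i, y i = true → i ∈ b := by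
  classical
  simp only [pointsBelow, Finset.mem_image, Finset.mem_powerset]
  constructor
  · rintro ⟨s, hs, rfl⟩ i hi
    exact hs (by simpa using hi)
  · intro h
    refine ⟨b.filter fun i => y i = true, Finset.filter_subset _ _, funext fun i => ?_⟩
    by_cases hi : y i = true
    · simp [hi, h i hi]
    · simp [hi]

theorem pointsBelow_subset_finSets (b : Finset ℕ) :
    (pointsBelow b : Set (ℕ → Bool)) ⊆ FinSets := fun _ hy =>
  b.finite_toSet.subset fun i hi => mem_pointsBelow.1 hy i hi

theorem card_pointsBelow_le (a : Finset ℕ) :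
    (pointsBelow (Finset.range a.card ∪ a)).card ≤ 4 ^ a.card := by
  classical
  refine Finset.card_image_le.trans ?_
  rw [Finset.card_powerset, show 4 = 2 ^ 2 from rfl, ← pow_mul]
  refine Nat.pow_le_pow_right two_pos ((Finset.card_union_le _ _).trans ?_)
  rw [Finset.card_range]
  omega

/-- A finite approximation to a sequence of sets `C n ∈ V n` and an infinite set `A`: the list
`sel` is an initial segment of the sequence and `stem` a finite part of `A`. The sets in `side`
are promised to contain the rest of `A`, and to belong to the rest of the sequence. The bound on
the length of `sel` leaves room to keep the promises of two conditions with the same `sel` and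
`stem` simultaneously. -/
structure Approx (V : ℕ → Set ClopenCode) (T : Set (ℕ → Bool)) where
  /-- the sets selected so far -/
  sel : List ClopenCode
  /-- the elements of the infinite set chosen so far -/
  stem : Finset ℕ
  /-- the points to which promises have been made -/
  side : Finset (ℕ → Bool)
  side_subset : (side : Set (ℕ → Bool)) ⊆ T
  sel_mem : ∀ n C, sel[n]? = some C → C ∈ V n
  room : 2 * side.card + 4 ^ stem.card ≤ sel.length

namespace Approx

variable {V : ℕ → Set ClopenCode} {T : Set (ℕ → Bool)}

/-- The points that a set selected after `p` has to contain when the stem is `b` by then: the side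
of `p`, and all subsets of `{0, …, k - 1} ∪ b`, where `k` is the number of elements of `p.stem`.
Since `k` is unbounded along a generic filter, sets almost contained in the generic infinite set
are eventually taken care of. -/
noncomputable def promised (p : Approx V T) (b : Finset ℕ) : Finset (ℕ → Bool) :=
  open Classical in p.side ∪ pointsBelow (Finset.range p.stem.card ∪ b)

theorem mem_promised {p : Approx V T} {b : Finset ℕ} {y : ℕ → Bool} :
    y ∈ p.promised b ↔ y ∈ p.side ∨ ∀ i, y i = true → i < p.stem.card ∨ i ∈ b := by
  simp [promised, mem_pointsBelow]

/-- New elements of the stem lie in every member of `p.side` and beyond the coordinates on which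
the sets already selected depend; newly selected sets contain all promised points. Because of the
former requirement, enlarging the stem later does not violate the latter. -/
instance : Preorder (Approx V T) where
  le q p := p.sel <+: q.sel ∧ p.stem ⊆ q.stem ∧ p.side ⊆ q.side ∧
    (∀ j ∈ q.stem, j ∉ p.stem → (∀ C ∈ p.sel, C.1 ≤ j) ∧ ∀ x ∈ p.side, x j = true) ∧
    ∀ n C, p.sel.length ≤ n → q.sel[n]? = some C →
      ∀ y ∈ p.promised q.stem, y ∈ C.toSet
  le_refl p := by
    refine ⟨List.prefix_rfl, subset_rfl, subset_rfl, fun j h h' => absurd h h', ?_⟩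
    intro n C hn hC
    rw [List.getElem?_eq_none hn] at hC
    cases hC
  le_trans r q p := by
    rintro ⟨h1, h2, h3, h4, h5⟩ ⟨k1, k2, k3, k4, k5⟩
    refine ⟨k1.trans h1, k2.trans h2, k3.trans h3, fun j hj hjp => ?_, fun n C hn hC y hy => ?_⟩
    · by_cases hjq : j ∈ q.stem
      · exact k4 j hjq hjp
      · exact ⟨fun C hC => (h4 j hj hjq).1 C (k1.subset hC),
          fun x hx => (h4 j hj hjq).2 x (k3 hx)⟩
    · rw [mem_promised] at hy
      rcases lt_or_ge n q.sel.length with hnq | hnq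
      · have hCq : q.sel[n]? = some C := by
          rw [← hC]
          rw [List.getElem?_eq_getElem hnq, List.prefix_iff_getElem?.1 h1 n hnq]
        have hCmem : C ∈ q.sel := List.mem_of_getElem? hCq
        rcases hy with hy | hy
        · exact k5 n C hn hCq y (mem_promised.2 (Or.inl hy))
        · -- below `C.1`, the sets `q.stem` and `r.stem` agree
          let y' : ℕ → Bool := fun i => y i && decide (i < C.1)
          have hy' : y' ∈ C.toSet := by
            refine k5 n C hn hCq y' (mem_promised.2 (Or.inr fun i hi => ?_))
            simp only [y', Bool.and_eq_true, decide_eq_true_eq] at hi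
            refine (hy i hi.1).imp_right fun hir => ?_
            by_contra hiq
            exact absurd ((h4 i hir hiq).1 C hCmem) (not_le.2 hi.2)
          refine (C.mem_toSet_congr fun i hi => ?_).1 hy'
          simp [y', hi]
      · refine h5 n C hnq hC y (mem_promised.2 (hy.imp (fun h => k3 h) fun h i hi => ?_))
        exact (h i hi).imp_left fun h => h.trans_le (Finset.card_le_card k2)

variable {p q : Approx V T}

theorem getElem?_of_le (h : q ≤ p) {n : ℕ} (hn : n < p.sel.length) : q.sel[n]? = p.sel[n]? := by
  rw [List.getElem?_eq_getElem hn, List.prefix_iff_getElem?.1 h.1 n hn]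

/-- Lists of selected sets can be prolonged, keeping finitely many points inside the new sets. -/
theorem exists_sel_extension (hV : IsNCovering V (T ∪ FinSets)) {l : List ClopenCode}
    (hc : ∀ n C, l[n]? = some C → C ∈ V n) {H : Finset (ℕ → Bool)}
    (hH : (H : Set (ℕ → Bool)) ⊆ T ∪ FinSets) (hcard : H.card ≤ l.length) (N : ℕ) :
    ∃ l' : List ClopenCode, l <+: l' ∧ N ≤ l'.length ∧ (∀ n C, l'[n]? = some C → C ∈ V n) ∧
      ∀ n C, l.length ≤ n → l'[n]? = some C → (H : Set (ℕ → Bool)) ⊆ C.toSet := by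
  induction N with
  | zero =>
    refine ⟨l, List.prefix_rfl, Nat.zero_le _, hc, fun n C hn hC => ?_⟩
    rw [List.getElem?_eq_none hn] at hC
    cases hC
  | succ N ih =>
    obtain ⟨l', h1, h2, h3, h4⟩ := ih
    obtain ⟨C₀, hC₀, hHC₀⟩ := hV l'.length H hH (hcard.trans h1.length_le)
    have key : ∀ n C, (l' ++ [C₀])[n]? = some C → l'[n]? = some C ∨ n = l'.length ∧ C = C₀ := by
      intro n C h
      rcases lt_trichotomy n l'.length with hn | hn | hn
      · left; rwa [List.getElem?_append_left hn] at h
      · right; subst hn; simpa [eq_comm] using h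
      · rw [List.getElem?_eq_none (by simp; omega)] at h; cases h
    refine ⟨l' ++ [C₀], h1.trans (List.prefix_append _ _), by simp; omega, fun n C h => ?_,
      fun n C hn h => ?_⟩
    · rcases key n C h with h | ⟨rfl, rfl⟩
      exacts [h3 n C h, hC₀]
    · rcases key n C h with h | ⟨rfl, rfl⟩
      exacts [h4 n C hn h, hHC₀]

/-- All conditions with the selection and the stem of `p` whose sides are contained in a small set
`F` have a common extension. Once the selection is long enough, arbitrary points of `T` may be
added to the side. -/
theorem exists_le_forall (hV : IsNCovering V (T ∪ FinSets)) (p : Approx V T)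
    {F G : Finset (ℕ → Bool)} (hF : (F : Set (ℕ → Bool)) ⊆ T) (hG : (G : Set (ℕ → Bool)) ⊆ T)
    (hcard : F.card + 4 ^ p.stem.card ≤ p.sel.length) (N : ℕ) :
    ∃ r : Approx V T, r.stem = p.stem ∧ G ⊆ r.side ∧ 2 * r.side.card + N ≤ r.sel.length ∧
      ∀ q : Approx V T, q.sel = p.sel → q.stem = p.stem → q.side ⊆ F → r ≤ q := by
  classical
  obtain ⟨c, h1, h2, h3, h4⟩ := exists_sel_extension hV p.sel_mem
    (H := F ∪ pointsBelow (Finset.range p.stem.card ∪ p.stem))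
    (by
      rw [Finset.coe_union]
      exact Set.union_subset_union hF (pointsBelow_subset_finSets _))
    ((Finset.card_union_le _ _).trans
      ((Nat.add_le_add_left (card_pointsBelow_le _) _).trans hcard))
    (2 * (F ∪ G).card + 4 ^ p.stem.card + N)
  have hpos : 0 < 4 ^ p.stem.card := by positivity
  refine ⟨⟨c, p.stem, F ∪ G, ?_, h3, by omega⟩, rfl, Finset.subset_union_right,
    by dsimp only; omega, ?_⟩
  · rw [Finset.coe_union]
    exact Set.union_subset hF hG
  · intro q hsel hstem hside
    refine ⟨hsel ▸ h1, hstem ▸ subset_rfl, hside.trans Finset.subset_union_left,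
      fun j hj hj' => absurd (hstem ▸ hj) hj', fun n C hn hC y hy => ?_⟩
    refine h4 n C (hsel ▸ hn) hC ?_
    rw [mem_promised] at hy
    rw [Finset.mem_coe, Finset.mem_union, mem_pointsBelow]
    refine hy.imp (fun h => hside h) fun h i hi => ?_
    simpa [hstem] using h i hi

/-- Two conditions with the same selection and the same stem are compatible, and there are only
countably many selections and stems. -/
theorem ccc (hV : IsNCovering V (T ∪ FinSets)) : CCC (Approx V T) := by
  classical
  intro A hA
  have hinj : Set.InjOn (fun p : Approx V T => (p.sel, p.stem)) A := by
    intro p hp q hq hpq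
    by_contra hne
    obtain ⟨hsel, hstem⟩ := Prod.ext_iff.1 hpq
    dsimp only at hsel hstem
    refine hA hp hq hne ?_
    have hcard : (p.side ∪ q.side).card + 4 ^ p.stem.card ≤ p.sel.length := by
      have h1 := Finset.card_union_le p.side q.side
      have h2 := p.room
      have h3 := q.room
      rw [← hsel, ← hstem] at h3
      omega
    obtain ⟨r, -, -, -, hr⟩ := exists_le_forall hV p (F := p.side ∪ q.side) (G := ∅)
      (by rw [Finset.coe_union]; exact Set.union_subset p.side_subset q.side_subset)
      (by simp) hcard 0
    exact ⟨r, hr p rfl rfl Finset.subset_union_left,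
      hr q hsel.symm hstem.symm Finset.subset_union_right⟩
  exact Set.MapsTo.countable_of_injOn (Set.mapsTo_univ _ A) hinj Set.countable_univ

theorem exists_le (hV : IsNCovering V (T ∪ FinSets)) (p : Approx V T)
    {G : Finset (ℕ → Bool)} (hG : (G : Set (ℕ → Bool)) ⊆ T) (N : ℕ) :
    ∃ r ≤ p, r.stem = p.stem ∧ G ⊆ r.side ∧ 2 * r.side.card + N ≤ r.sel.length := by
  obtain ⟨r, h1, h2, h3, h4⟩ := exists_le_forall hV p p.side_subset hG
    (by have := p.room; omega) N
  exact ⟨r, h4 p rfl rfl subset_rfl, h1, h2, h3⟩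

end Approx
/-- The strong finite intersection property: finitely many members of `T` have infinite
intersection. -/
def HasSFIP (T : Set (ℕ → Bool)) : Prop :=
  ∀ F : Finset (ℕ → Bool), (F : Set (ℕ → Bool)) ⊆ T → {n | ∀ x ∈ F, x n = true}.Infinite

namespace Approx

variable {V : ℕ → Set ClopenCode} {T : Set (ℕ → Bool)}

theorem exists_le_card_stem (hV : IsNCovering V (T ∪ FinSets)) (hT : HasSFIP T)
    (p : Approx V T) (k : ℕ) : ∃ q ≤ p, k ≤ q.stem.card := by
  classical
  induction k with
  | zero => exact ⟨p, le_rfl, Nat.zero_le _⟩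
  | succ k ih =>
    obtain ⟨q, hqp, hq⟩ := ih
    -- first make room for one more element of the stem
    obtain ⟨r, hrq, hstem, -, hroom⟩ := exists_le hV q (G := ∅) (by simp)
      (4 ^ (q.stem.card + 1))
    obtain ⟨j, hj, hjlt⟩ := (hT r.side r.side_subset).exists_gt
      ((r.sel.toFinset.sup fun C => C.1) + r.stem.sup id)
    have hjC : ∀ C ∈ r.sel, C.1 ≤ j := fun C hC => by
      have := Finset.le_sup (f := fun C : ClopenCode => C.1) (List.mem_toFinset.2 hC)
      omega
    have hjr : j ∉ r.stem := fun h => by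
      have := Finset.le_sup (f := id) h
      dsimp only [id] at this
      omega
    have hcard : (insert j r.stem).card = q.stem.card + 1 := by
      rw [Finset.card_insert_of_notMem hjr, hstem]
    refine ⟨⟨r.sel, insert j r.stem, r.side, r.side_subset, r.sel_mem, by rw [hcard]; omega⟩,
      le_trans (b := r) ⟨List.prefix_rfl, Finset.subset_insert _ _, subset_rfl, fun i hi hi' => ?_,
        fun n C hn hC => ?_⟩ (hrq.trans hqp), by dsimp only; omega⟩
    · obtain rfl := (Finset.mem_insert.1 hi).resolve_right hi'
      exact ⟨hjC, hj⟩
    · rw [List.getElem?_eq_none hn] at hC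
      cases hC

end Approx

/-- The sets added by Martin's Axiom: a pseudointersection `z` of `T`, together with a selection
from `V` that is eventually correct at the points of `T` and at all points almost contained
in `z`. -/
theorem MartinsAxiom.exists_pseudointersection (hMA : MartinsAxiom) {V : ℕ → Set ClopenCode}
    {T : Set (ℕ → Bool)} (hcard : #T < 𝔠) (hV : IsNCovering V (T ∪ FinSets)) (hT : HasSFIP T) :
    ∃ z : ℕ → Bool, {n | z n = true}.Infinite ∧ (∀ x ∈ T, AlmostSubset z x) ∧
      ∃ C : ℕ → ClopenCode, (∀ n, C n ∈ V n) ∧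
        ∀ y, y ∈ T ∨ AlmostSubset y z → ∀ᶠ n in atTop, y ∈ (C n).toSet := by
  classical
  -- an initial condition needs a selection of length `1 = 4 ^ 0`, even for the empty stem
  obtain ⟨c, -, hclen, hcV, -⟩ := Approx.exists_sel_extension hV (l := []) (by simp)
    (H := ∅) (by simp) (by simp) 1
  have : Nonempty (Approx V T) := ⟨⟨c, ∅, ∅, by simp, hcV, by simpa using hclen⟩⟩
  obtain ⟨G, hG⟩ := hMA (Approx V T) (Approx.ccc hV)
    (Set.range (fun x : T => {p : Approx V T | x.1 ∈ p.side}) ∪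
      Set.range fun k : ℕ => {p : Approx V T | k ≤ p.stem.card ∧ k ≤ p.sel.length})
    ((mk_union_le _ _).trans_lt (add_lt_of_lt aleph0_le_continuum (mk_range_le.trans_lt hcard)
      (mk_range_le.trans_lt (mk_nat ▸ aleph0_lt_continuum))))
    (by
      rintro _ (⟨x, rfl⟩ | ⟨k, rfl⟩) p
      · obtain ⟨q, hq, -, hxq, -⟩ := Approx.exists_le hV p (G := {x.1}) (by simp) 0
        exact ⟨q, hxq (Finset.mem_singleton_self _), hq⟩
      · obtain ⟨q, hq, hk⟩ := Approx.exists_le_card_stem hV hT p k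
        obtain ⟨r, hr, hstem, -, hlen⟩ := Approx.exists_le hV q (G := ∅) (by simp) k
        exact ⟨r, ⟨hstem ▸ hk, by omega⟩, hr.trans hq⟩)
  have hside : ∀ x ∈ T, ∃ p ∈ G, x ∈ p.side := fun x hx => by
    obtain ⟨p, hp, hpG⟩ := hG _ (Or.inl ⟨⟨x, hx⟩, rfl⟩)
    exact ⟨p, hpG, hp⟩
  have hlong : ∀ k : ℕ, ∃ p ∈ G, k ≤ p.stem.card ∧ k ≤ p.sel.length := fun k => by
    obtain ⟨p, hp, hpG⟩ := hG _ (Or.inr ⟨k, rfl⟩)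
    exact ⟨p, hpG, hp⟩
  have hdir : ∀ p ∈ G, ∀ q ∈ G, ∃ r ∈ G, r ≤ p ∧ r ≤ q := fun p hp q hq =>
    G.directed p hp q hq
  have hC : ∀ n, ∃ C, ∃ p ∈ G, p.sel[n]? = some C := fun n => by
    obtain ⟨p, hpG, -, hp⟩ := hlong (n + 1)
    exact ⟨_, p, hpG, List.getElem?_eq_getElem hp⟩
  choose C hC using hC
  have hCeq : ∀ n, ∀ p ∈ G, n < p.sel.length → p.sel[n]? = some (C n) := by
    intro n p hp hn
    obtain ⟨q, hq, hqC⟩ := hC n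
    obtain ⟨r, -, hrp, hrq⟩ := hdir p hp q hq
    rw [← Approx.getElem?_of_le hrp hn, Approx.getElem?_of_le hrq, hqC]
    by_contra hlt
    rw [List.getElem?_eq_none (not_lt.1 hlt)] at hqC
    cases hqC
  have hbelow : ∀ p ∈ G, ∀ n, ∃ r ∈ G, r ≤ p ∧ r.sel[n]? = some (C n) := by
    intro p hp n
    obtain ⟨q, hqG, -, hq⟩ := hlong (n + 1)
    obtain ⟨r, hr, hrp, hrq⟩ := hdir p hp q hqG
    refine ⟨r, hr, hrp, ?_⟩
    rw [Approx.getElem?_of_le hrq hq]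
    exact hCeq n q hqG hq
  let z : ℕ → Bool := fun i => decide (∃ p ∈ G, i ∈ p.stem)
  have hz : ∀ i, z i = true ↔ ∃ p ∈ G, i ∈ p.stem := fun i => by simp [z]
  refine ⟨z, fun hfin => ?_, fun x hx => ?_, C, fun n => ?_, ?_⟩
  · obtain ⟨p, hpG, hp, -⟩ := hlong (hfin.toFinset.card + 1)
    have : p.stem ⊆ hfin.toFinset := fun i hi => by simpa using (hz i).2 ⟨p, hpG, hi⟩
    exact absurd (Finset.card_le_card this) (by omega)
  · obtain ⟨p, hpG, hp⟩ := hside x hx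
    refine p.stem.finite_toSet.subset fun j hj => ?_
    obtain ⟨q, hqG, hq⟩ := (hz j).1 hj.1
    obtain ⟨r, -, hrp, hrq⟩ := hdir p hpG q hqG
    by_contra hjp
    have := (hrp.2.2.2.1 j (hrq.2.1 hq) hjp).2 x hp
    rw [hj.2] at this
    cases this
  · obtain ⟨p, -, hp⟩ := hC n
    exact p.sel_mem n _ hp
  · rintro y (hy | hy)
    · obtain ⟨p, hpG, hp⟩ := hside y hy
      filter_upwards [eventually_ge_atTop p.sel.length] with n hn
      obtain ⟨r, hrG, hrp, hr⟩ := hbelow p hpG n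
      exact hrp.2.2.2.2 n _ hn hr y (Approx.mem_promised.2 (Or.inl hp))
    · obtain ⟨l, hl⟩ := hy.bddAbove
      obtain ⟨p, hpG, hp, -⟩ := hlong (l + 1)
      filter_upwards [eventually_ge_atTop p.sel.length] with n hn
      obtain ⟨r, hrG, hrp, hr⟩ := hbelow p hpG n
      -- only the part of `y` below the support of `C n` matters, and that part of `z` is
      -- contained in `r.stem`
      let y' : ℕ → Bool := fun i => y i && decide (i < (C n).1)
      have hy' : y' ∈ (C n).toSet := by
        refine hrp.2.2.2.2 n _ hn hr y' (Approx.mem_promised.2 (Or.inr fun i hi => ?_))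
        simp only [y', Bool.and_eq_true, decide_eq_true_eq] at hi
        by_cases hzi : z i = true
        · obtain ⟨q, hqG, hq⟩ := (hz i).1 hzi
          obtain ⟨s, -, hsr, hsq⟩ := hdir r hrG q hqG
          by_contra! hcon
          exact absurd ((hsr.2.2.2.1 i (hsq.2.1 hq) hcon.2).1 _ (List.mem_of_getElem? hr))
            (not_le.2 hi.2)
        · exact Or.inl ((Nat.lt_succ_of_le (hl ⟨hi.1, by simpa using hzi⟩)).trans_le hp)
      refine ((C n).mem_toSet_congr fun i hi => ?_).1 hy'
      simp [y', hi]

/-! ### The tower -/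

/-- An infinite set contains infinite subsets that are arbitrarily sparse. -/
theorem exists_sparse_subset {a : ℕ → Bool} (ha : {n | a n = true}.Infinite) (g : ℕ → ℕ) :
    ∃ z : ℕ → Bool, {n | z n = true}.Infinite ∧ (∀ n, z n = true → a n = true) ∧
      ∀ n, Nat.count (fun i => z i = true) (g n) ≤ n := by
  classical
  obtain ⟨φ, hφ, hφa⟩ := extraction_forall_of_frequently
    (P := fun n k => a k = true ∧ ∀ j ≤ n, g j ≤ k) fun n =>
      (Nat.frequently_atTop_iff_infinite.2 ha).and_eventually
        ((eventually_ge_atTop ((Finset.range (n + 1)).sup g)).mono fun k hk j hj =>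
          (Finset.le_sup (Finset.mem_range.2 (Nat.lt_succ_of_le hj))).trans hk)
  have hz : ∀ n, decide (n ∈ Set.range φ) = true ↔ n ∈ Set.range φ := fun n => decide_eq_true_iff
  refine ⟨fun n => decide (n ∈ Set.range φ), ?_, fun n hn => ?_, fun n => ?_⟩
  · simp only [hz]
    exact Set.infinite_range_of_injective hφ.injective
  · obtain ⟨k, rfl⟩ := (hz n).1 hn
    exact (hφa k).1
  · rw [Nat.count_eq_card_filter_range]
    -- the elements of `z` below `g n` are among `φ 0, …, φ (n - 1)`
    refine (Finset.card_le_card (t := (Finset.range n).image φ) fun i hi => ?_).trans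
      (Finset.card_image_le.trans (Finset.card_range n).le)
    simp only [Finset.mem_filter, Finset.mem_range, hz] at hi
    obtain ⟨hi, k, rfl⟩ := hi
    refine Finset.mem_image_of_mem _ (Finset.mem_range.2 ?_)
    by_contra! hnk
    exact absurd ((hφa k).2 n hnk) (not_le.2 hi)

/-- `z` is a sparse pseudointersection of `T`, and if `V` is `n`-covering for the points of
`T ∪ Fin` then it has a selection that captures all points of `T` and all sets almost contained
in `z`. -/
def IsNext (V : ℕ → Set ClopenCode) (g : ℕ → ℕ) (T : Set (ℕ → Bool)) (z : ℕ → Bool) : Prop :=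
  {n | z n = true}.Infinite ∧ (∀ x ∈ T, AlmostSubset z x) ∧
    (∀ n, Nat.count (fun i => z i = true) (g n) ≤ n) ∧
    (IsNCovering V (T ∪ FinSets) → ∃ C : ℕ → ClopenCode, (∀ n, C n ∈ V n) ∧
      ∀ y, y ∈ T ∨ AlmostSubset y z → ∀ᶠ n in atTop, y ∈ (C n).toSet)

theorem MartinsAxiom.exists_isNext (hMA : MartinsAxiom) (V : ℕ → Set ClopenCode) (g : ℕ → ℕ)
    {T : Set (ℕ → Bool)} (hcard : #T < 𝔠) (hT : HasSFIP T) : ∃ z, IsNext V g T z := by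
  classical
  have hmono : ∀ a z : ℕ → Bool, (∀ n, z n = true → a n = true) → AlmostSubset z a := by
    intro a z h
    refine Set.finite_empty.subset fun n hn => ?_
    have := h n hn.1
    rw [hn.2] at this
    cases this
  by_cases hV : IsNCovering V (T ∪ FinSets)
  · obtain ⟨a, ha, haT, C, hC, hCa⟩ := hMA.exists_pseudointersection hcard hV hT
    obtain ⟨z, hz, hza, hzg⟩ := exists_sparse_subset ha g
    exact ⟨z, hz, fun x hx => (hmono a z hza).trans (haT x hx), hzg, fun _ => ⟨C, hC, fun y hy =>
      hCa y (hy.imp_right fun h => h.trans (hmono a z hza))⟩⟩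
  · -- apply the previous case to the families consisting of all clopen sets
    have hU : IsNCovering (fun _ => Set.univ) (T ∪ FinSets) := fun n H _ _ => by
      obtain ⟨C, hC, -⟩ := ClopenCode.exists_between (F := H) isOpen_univ (Set.subset_univ _)
      exact ⟨C, trivial, hC⟩
    obtain ⟨a, ha, haT, -⟩ := hMA.exists_pseudointersection hcard hU hT
    obtain ⟨z, hz, hza, hzg⟩ := exists_sparse_subset ha g
    exact ⟨z, hz, fun x hx => (hmono a z hza).trans (haT x hx), hzg, fun h => absurd h hV⟩

theorem HasSFIP.of_chain {T : Set (ℕ → Bool)} (hinf : ∀ x ∈ T, {n | x n = true}.Infinite)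
    (hchain : ∀ x ∈ T, ∀ y ∈ T, AlmostSubset x y ∨ AlmostSubset y x) : HasSFIP T := by
  classical
  intro F hF
  -- a nonempty finite chain has a least element
  have hmin : ∃ z : ℕ → Bool, {n | z n = true}.Infinite ∧ (z ∈ T ∨ F = ∅) ∧
      ∀ x ∈ F, AlmostSubset z x := by
    induction F using Finset.induction_on with
    | empty =>
      exact ⟨fun _ => true, by simpa using Set.infinite_univ, Or.inr rfl, by simp⟩
    | insert x F _ ih =>
      rw [Finset.coe_insert, Set.insert_subset_iff] at hF
      obtain ⟨z, hz, hzT, hzF⟩ := ih hF.2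
      have hx : AlmostSubset x z ∨ (AlmostSubset z x ∧ z ∈ T) ∨ F = ∅ := by
        rcases hzT with hzT | hzT
        · exact (hchain x hF.1 z hzT).imp_right fun h => Or.inl ⟨h, hzT⟩
        · exact Or.inr (Or.inr hzT)
      rcases hx with h | ⟨h, hzT⟩ | rfl
      · refine ⟨x, hinf x hF.1, Or.inl hF.1, fun y hy => ?_⟩
        rcases Finset.mem_insert.1 hy with rfl | hy
        exacts [AlmostSubset.refl _, h.trans (hzF y hy)]
      · refine ⟨z, hz, Or.inl hzT, fun y hy => ?_⟩
        rcases Finset.mem_insert.1 hy with rfl | hy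
        exacts [h, hzF y hy]
      · refine ⟨x, hinf x hF.1, Or.inl hF.1, fun y hy => ?_⟩
        rw [Finset.mem_insert, or_iff_left (Finset.notMem_empty y)] at hy
        exact hy ▸ AlmostSubset.refl _
  obtain ⟨z, hz, -, hzF⟩ := hmin
  refine fun hfin => hz ((hfin.union (F.finite_toSet.biUnion hzF)).subset fun n hn => ?_)
  by_cases h : ∀ x ∈ F, x n = true
  · exact Or.inl h
  · push Not at h
    obtain ⟨x, hx, hxn⟩ := h
    exact Or.inr (Set.mem_biUnion hx ⟨hn, by simpa using hxn⟩)

/-- Transfinite recursion with a constraint on the next point in terms of the set of earlier points.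
The constraint holds wherever it can be met. -/
theorem exists_transfinite_sequence {I : Type} (r : I → I → Prop) [IsWellFounded I r]
    (P : I → Set (ℕ → Bool) → (ℕ → Bool) → Prop) :
    ∃ x : I → ℕ → Bool, ∀ t, (∃ z, P t (x '' {s | r s t}) z) →
      P t (x '' {s | r s t}) (x t) := by
  classical
  let step : ∀ t, (∀ s, r s t → ℕ → Bool) → ℕ → Bool := fun t ih =>
    Classical.epsilon (P t {y | ∃ s, ∃ h : r s t, ih s h = y})
  refine ⟨IsWellFounded.fix r step, fun t ht => ?_⟩
  have himage : IsWellFounded.fix r step '' {s | r s t} =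
      {y | ∃ s, ∃ _ : r s t, IsWellFounded.fix r step s = y} := by
    ext y; simp
  rw [himage] at ht ⊢
  rw [IsWellFounded.fix_eq r step t]
  exact Classical.epsilon_spec ht

/-- Under Martin's Axiom there is a family `Y` of infinite sets, linearly ordered by almost
inclusion, which contains sets of every degree of sparseness and such that `Y ∪ Fin` has the
strong `γ`-property with respect to clopen sets. -/
theorem MartinsAxiom.exists_tower (hMA : MartinsAxiom) :
    ∃ Y : Set (ℕ → Bool), (∀ x ∈ Y, {n | x n = true}.Infinite) ∧
      (∀ x ∈ Y, ∀ y ∈ Y, AlmostSubset x y ∨ AlmostSubset y x) ∧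
      (∀ g : ℕ → ℕ, ∃ z ∈ Y, ∀ n, Nat.count (fun i => z i = true) (g n) ≤ n) ∧
      ∀ V, IsNCovering V (Y ∪ FinSets) → ∃ C : ℕ → ClopenCode, (∀ n, C n ∈ V n) ∧
        ∀ y ∈ Y ∪ FinSets, ∀ᶠ n in atTop, y ∈ (C n).toSet := by
  classical
  let I : Type := (ℕ → Set ClopenCode) × (ℕ → ℕ)
  have hI : #I = 𝔠 := by
    have h1 : #(ℕ → Set ClopenCode) = 𝔠 := by
      rw [← power_def, mk_set, mk_eq_aleph0 ClopenCode, mk_nat, two_power_aleph0,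
        continuum_power_aleph0]
    have h2 : #(ℕ → ℕ) = 𝔠 := by
      rw [← power_def, mk_nat, aleph0_power_aleph0]
    rw [mk_prod, lift_id, lift_id, h1, h2, continuum_mul_self]
  -- all proper initial segments of this well-ordering have fewer than continuum many elements
  obtain ⟨r, hr, hord⟩ := exists_ord_eq I
  obtain ⟨x, hx⟩ := exists_transfinite_sequence r fun t : I => IsNext t.1 t.2
  have hnext : ∀ t, IsNext t.1 t.2 (x '' {s | r s t}) (x t) := by
    intro t
    induction t using IsWellFounded.induction r with
    | ind t ih =>
      refine hx t (hMA.exists_isNext _ _ ?_ (HasSFIP.of_chain ?_ ?_))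
      · refine mk_image_le.trans_lt ?_
        have := card_typein_lt (r := r) t hord
        rw [hI] at this
        exact this
      · rintro _ ⟨s, hs, rfl⟩
        exact (ih s hs).1
      · rintro _ ⟨s, hs, rfl⟩ _ ⟨s', hs', rfl⟩
        rcases trichotomous_of r s s' with h | rfl | h
        · exact Or.inr ((ih s' hs').2.1 _ ⟨s, h, rfl⟩)
        · exact Or.inl (AlmostSubset.refl _)
        · exact Or.inl ((ih s hs).2.1 _ ⟨s', h, rfl⟩)
  refine ⟨Set.range x, ?_, ?_, fun g => ?_, fun V hV => ?_⟩
  · rintro _ ⟨t, rfl⟩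
    exact (hnext t).1
  · rintro _ ⟨s, rfl⟩ _ ⟨s', rfl⟩
    rcases trichotomous_of r s s' with h | rfl | h
    · exact Or.inr ((hnext s').2.1 _ ⟨s, h, rfl⟩)
    · exact Or.inl (AlmostSubset.refl _)
    · exact Or.inl ((hnext s).2.1 _ ⟨s', h, rfl⟩)
  · exact ⟨x (fun _ => ∅, g), ⟨_, rfl⟩, (hnext (fun _ => ∅, g)).2.2.1⟩
  · let t : I := (V, fun _ => 0)
    obtain ⟨C, hC, hCy⟩ := (hnext t).2.2.2 fun n H hH hn =>
      hV n H (hH.trans (Set.union_subset_union_left _ (Set.image_subset_range _ _))) hn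
    refine ⟨C, hC, ?_⟩
    rintro _ (⟨s, rfl⟩ | hy)
    · refine hCy _ ?_
      rcases trichotomous_of r s t with h | rfl | h
      · exact Or.inl ⟨s, h, rfl⟩
      · exact Or.inr (AlmostSubset.refl _)
      · exact Or.inr ((hnext s).2.1 _ ⟨t, h, rfl⟩)
    · exact hCy _ (Or.inr (Set.Finite.subset hy fun n hn => hn.1))

/-! ### The selection principles -/

theorem isStrongGammaSet_of_clopen {X : Set (ℕ → Bool)}
    (hX : ∀ V, IsNCovering V X → ∃ C : ℕ → ClopenCode, (∀ n, C n ∈ V n) ∧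
      ∀ y ∈ X, ∀ᶠ n in atTop, y ∈ (C n).toSet) : IsStrongGammaSet ↥X := by
  classical
  intro 𝒰 h𝒰
  -- replace each cover by the clopen sets whose traces refine it
  obtain ⟨C, hC, hCX⟩ := hX (fun n => {C | ∃ U ∈ 𝒰 n, ∀ x : X, x.1 ∈ C.toSet → x ∈ U}) (by
    intro n H hHX hn
    obtain ⟨U, hU, hHU⟩ := (h𝒰 n).2.2 (H.subtype (· ∈ X))
      ((Finset.card_subtype _ _).trans_le ((Finset.card_filter_le _ _).trans hn))
    obtain ⟨O, hO, rfl⟩ := isOpen_induced_iff.1 ((h𝒰 n).1 U hU)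
    obtain ⟨C, hHC, hCO⟩ := ClopenCode.exists_between (F := H) hO fun x hx =>
      hHU (show (⟨x, hHX hx⟩ : X) ∈ (H.subtype (· ∈ X) : Set X) by simpa using hx)
    exact ⟨C, ⟨_, hU, fun x hx => hCO hx⟩, hHC⟩)
  choose U hU hCU using hC
  have hev : ∀ x : X, ∀ᶠ n in atTop, x ∈ U n := fun x =>
    (hCX x x.2).mono fun n hn => hCU n x hn
  have huniv : Set.univ ∉ Set.range U := by
    rintro ⟨n, hn⟩
    exact (h𝒰 n).2.1.2 (hn ▸ hU n)
  refine ⟨U, hU, ⟨⟨?_, huniv⟩, fun hfin => ?_, fun x => ?_⟩, hev⟩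
  · refine Set.eq_univ_of_forall fun x => ?_
    obtain ⟨n, hn⟩ := (hev x).exists
    exact ⟨U n, ⟨n, rfl⟩, hn⟩
  · -- a set selected infinitely often would contain all points
    have : Finite (Set.range U) := hfin
    obtain ⟨⟨W, hW⟩, hWinf⟩ := Finite.exists_infinite_fiber (Set.rangeFactorization U)
    have hWinf : {n | U n = W}.Infinite :=
      (Set.infinite_coe_iff.1 hWinf).mono fun n hn =>
        congrArg Subtype.val (show Set.rangeFactorization U n = ⟨W, hW⟩ from hn)
    refine huniv ((Set.eq_univ_of_forall fun x => ?_) ▸ hW)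
    obtain ⟨n, hn, hxn⟩ :=
      ((Nat.frequently_atTop_iff_infinite.2 hWinf).and_eventually (hev x)).exists
    exact hn ▸ hxn
  · have hfin : {n | x ∉ U n}.Finite := by
      have := hev x
      rwa [← Nat.cofinite_eq_atTop, eventually_cofinite] at this
    refine (hfin.image U).subset ?_
    rintro _ ⟨⟨n, rfl⟩, hn⟩
    exact ⟨n, hn, rfl⟩

/-- If the infinite sets in `Y` are arbitrarily sparse, then `Y` does not have Menger's property:
for fixed `n`, the sets of all `x ∈ Y` with more than `n` elements below `m`, where `m ∈ ℕ`, form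
an increasing cover. -/
theorem not_ufin_of_sparse {Y : Set (ℕ → Bool)} (hinf : ∀ x ∈ Y, {n | x n = true}.Infinite)
    (hsparse : ∀ g : ℕ → ℕ, ∃ z ∈ Y, ∀ n, Nat.count (fun i => z i = true) (g n) ≤ n) :
    ¬ Ufin (GammaCovers ↥Y) (OpenCovers ↥Y) := by
  classical
  let W : ℕ → ℕ → Set Y := fun n m => {x | n < Nat.count (fun i => x.1 i = true) m}
  have hWmono : ∀ n, Monotone (W n) := fun n m m' h x hx =>
    lt_of_lt_of_le hx (Nat.count_monotone _ h)
  have hWopen : ∀ n m, IsOpen (W n m) := by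
    intro n m
    have hcont : Continuous fun x : Y => Nat.count (fun i => x.1 i = true) m := by
      simp only [Nat.count_eq_card_filter_range, Finset.card_filter]
      refine continuous_finsetSum _ fun i _ => ?_
      exact (continuous_of_discreteTopology (f := fun b : Bool => if b = true then 1 else 0)).comp
        ((continuous_apply i).comp continuous_subtype_val)
    exact (isOpen_discrete (Set.Ioi n)).preimage hcont
  have hWmem : ∀ n, ∀ x : Y, ∃ m, x ∈ W n m := by
    intro n x
    refine ⟨Nat.nth (fun i => x.1 i = true) n + 1, ?_⟩
    have h := Nat.count_nth_succ_of_infinite (p := fun i => x.1 i = true) (hinf x x.2) n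
    exact Nat.lt_of_lt_of_eq (Nat.lt_succ_self n) h.symm
  have hWbound : ∀ n, ∀ ℱ ⊆ Set.range (W n), ℱ.Finite → ∃ M, ∀ U ∈ ℱ, U ⊆ W n M := by
    intro n ℱ hsub hfin
    choose! m hm using hsub
    obtain ⟨M, hM⟩ := (hfin.image m).bddAbove
    exact ⟨M, fun U hU => (hm hU).symm.subset.trans (hWmono n (hM ⟨U, hU, rfl⟩))⟩
  have hnot : ∀ M : ℕ → ℕ, ∃ z : Y, ∀ n, z ∉ W n (M n) := fun M => by
    obtain ⟨z, hz, hzM⟩ := hsparse M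
    exact ⟨⟨z, hz⟩, fun n => not_lt.2 (hzM n)⟩
  have hnofin : ∀ n, ∀ ℱ ⊆ Set.range (W n), ℱ.Finite → ⋃₀ ℱ ≠ Set.univ := by
    intro n ℱ hsub hfin huniv
    obtain ⟨M, hM⟩ := hWbound n ℱ hsub hfin
    obtain ⟨z, hz⟩ := hnot fun _ => M
    obtain ⟨U, hU, hzU⟩ := huniv.symm.subset (Set.mem_univ z)
    exact hz n (hM U hU hzU)
  have hcover : ∀ n, ⋃₀ Set.range (W n) = Set.univ := fun n =>
    Set.eq_univ_of_forall fun x => by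
      obtain ⟨m, hm⟩ := hWmem n x
      exact ⟨_, ⟨m, rfl⟩, hm⟩
  intro hU
  obtain ⟨ℱ, hℱ, -, -, hcov, -⟩ := hU (fun n => Set.range (W n)) (fun n => by
    refine ⟨Set.countable_range _, ?_, ⟨hcover n, fun h => ?_⟩, fun h => ?_, fun x => ?_⟩
    · rintro _ ⟨m, rfl⟩
      exact hWopen n m
    · exact hnofin n {Set.univ} (Set.singleton_subset_iff.2 h) (Set.finite_singleton _)
        (Set.sUnion_singleton _)
    · exact hnofin n _ subset_rfl h (hcover n)
    · obtain ⟨m, hm⟩ := hWmem n x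
      refine ((Set.finite_lt_nat m).image (W n)).subset ?_
      rintro _ ⟨⟨k, rfl⟩, hk⟩
      refine ⟨k, ?_, rfl⟩
      by_contra hmk
      exact hk (hWmono n (not_lt.1 hmk) hm)) hnofin
  choose M hM using fun n => hWbound n (ℱ n) (hℱ n).1 (hℱ n).2
  obtain ⟨z, hz⟩ := hnot M
  obtain ⟨_, ⟨n, rfl⟩, U, hU, hzU⟩ := hcov.symm.subset (Set.mem_univ z)
  exact hz n (hM n U hU hzU)

/-- A family of infinite sets which is linearly ordered by almost inclusion and contains
arbitrarily sparse sets is not a `τ`-set: the sets `{x ∈ Y | n ∈ x}` form a `τ`-cover, but a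
`γ`-cover consisting of such sets would give a pseudointersection of `Y`. -/
theorem not_isTauSet_of_sparse {Y : Set (ℕ → Bool)}
    (hinf : ∀ x ∈ Y, {n | x n = true}.Infinite)
    (hchain : ∀ x ∈ Y, ∀ y ∈ Y, AlmostSubset x y ∨ AlmostSubset y x)
    (hsparse : ∀ g : ℕ → ℕ, ∃ z ∈ Y, ∀ n, Nat.count (fun i => z i = true) (g n) ≤ n) :
    ¬ IsTauSet ↥Y := by
  classical
  let O : ℕ → Set Y := fun n => {x | x.1 n = true}
  have hO : ∀ n, IsClopen (O n) := fun n =>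
    (isClopen_discrete ({true} : Set Bool)).preimage
      ((continuous_apply n).comp continuous_subtype_val)
  have hgap : ∀ M, ∃ z : Y, ∀ i < M, z ∉ O i := by
    intro M
    obtain ⟨z, hz, hzM⟩ := hsparse fun _ => M
    refine ⟨⟨z, hz⟩, fun i hi hzi => ?_⟩
    have h1 : 0 < Nat.count (fun i => z i = true) (i + 1) := by
      rw [Nat.count_succ, if_pos (show z i = true from hzi)]
      omega
    exact absurd ((h1.trans_le (Nat.count_monotone _ hi)).trans_le (hzM 0)) (lt_irrefl _)
  have hmeet : ∀ x y : Y, ∃ n, x ∈ O n ∧ y ∈ O n := by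
    intro x y
    rcases hchain x x.2 y y.2 with h | h
    · exact (h.infinite_inter (hinf x x.2)).nonempty
    · obtain ⟨n, hn⟩ := (h.infinite_inter (hinf y y.2)).nonempty
      exact ⟨n, hn.2, hn.1⟩
  have hτ : IsTauCover (Set.range O) := by
    refine ⟨⟨Set.eq_univ_of_forall fun x => ?_, ?_⟩, fun x hfin => ?_, fun x y => ?_⟩
    · obtain ⟨n, hn, -⟩ := hmeet x x
      exact ⟨O n, ⟨n, rfl⟩, hn⟩
    · rintro ⟨n, hn⟩
      obtain ⟨z, hz⟩ := hgap (n + 1)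
      exact hz n n.lt_succ_self (hn ▸ Set.mem_univ z)
    · -- If the sets `O n` with `n ∈ x` were all among `O 0, …, O M`, then a set `z` in the family
      -- without elements up to `M` would be disjoint from `x`.
      obtain ⟨R, hR⟩ : ∃ R : Set ℕ, R.Finite ∧ O '' R = {U ∈ Set.range O | x ∈ U} := by
        obtain ⟨R, -, hR⟩ := Set.SurjOn.exists_bijOn_subset
          (f := O) (s := Set.univ) (t := {U ∈ Set.range O | x ∈ U}) (by
            rintro _ ⟨⟨n, rfl⟩, -⟩
            exact ⟨n, trivial, rfl⟩)
        exact ⟨R, hR.finite_iff_finite.2 hfin, hR.image_eq⟩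
      obtain ⟨M, hM⟩ := hR.1.bddAbove
      obtain ⟨z, hz⟩ := hgap (M + 1)
      obtain ⟨n, hxn, hzn⟩ := hmeet x z
      obtain ⟨i, hi, hin⟩ := hR.2.symm.subset ⟨⟨n, rfl⟩, hxn⟩
      exact hz i (Nat.lt_succ_of_le (hM hi)) (hin ▸ hzn)
    · refine (hchain x x.2 y y.2).imp (fun h => ?_) fun h => ?_ <;>
      · refine (Set.Finite.image O h).subset ?_
        rintro _ ⟨⟨n, rfl⟩, hn, hn'⟩
        exact ⟨n, ⟨hn, by simpa [O] using hn'⟩, rfl⟩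
  intro hY
  obtain ⟨𝒱, h𝒱, -, h𝒱inf, h𝒱fin⟩ := hY (Set.range O) (by rintro _ ⟨n, rfl⟩; exact hO n) hτ
  obtain ⟨B, -, hB⟩ := Set.SurjOn.exists_bijOn_subset (f := O) (s := Set.univ) (t := 𝒱) (by
    intro U hU
    obtain ⟨n, rfl⟩ := h𝒱 hU
    exact ⟨n, trivial, rfl⟩)
  have hBinf : B.Infinite := fun h => h𝒱inf (hB.finite_iff_finite.1 h)
  -- `B` is a pseudointersection of `Y`
  have hBY : ∀ x : Y, {n ∈ B | x ∉ O n}.Finite := fun x => by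
    refine Set.Finite.of_finite_image ((h𝒱fin x).subset ?_) (hB.injOn.mono fun n hn => hn.1)
    rintro _ ⟨n, hn, rfl⟩
    exact ⟨hB.mapsTo hn.1, hn.2⟩
  -- `z` has at most `n` elements below the point where `B` has `2 * n + 1` elements; for `n` the
  -- number of elements of `B` outside `z`, this is a contradiction
  obtain ⟨z, hz, hzg⟩ := hsparse fun n => Nat.nth (· ∈ B) (2 * n) + 1
  have hfin := hBY ⟨z, hz⟩
  let k := hfin.toFinset.card
  have h1 : Nat.count (· ∈ B) (Nat.nth (· ∈ B) (2 * k) + 1) = 2 * k + 1 :=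
    Nat.count_nth_succ_of_infinite (p := fun i => i ∈ B) hBinf _
  have h2 := hzg k
  rw [Nat.count_eq_card_filter_range] at h1 h2
  have h3 : (Finset.range (Nat.nth (· ∈ B) (2 * k) + 1)).filter (· ∈ B) ⊆
      (Finset.range (Nat.nth (· ∈ B) (2 * k) + 1)).filter (fun i => z i = true) ∪
        hfin.toFinset := by
    intro i hi
    rw [Finset.mem_filter] at hi
    rw [Finset.mem_union, Finset.mem_filter, Set.Finite.mem_toFinset]
    by_cases hzi : z i = true
    · exact Or.inl ⟨hi.1, hzi⟩
    · exact Or.inr ⟨hi.2, hzi⟩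
  have h4 := (Finset.card_le_card h3).trans (Finset.card_union_le _ _)
  have h5 : hfin.toFinset.card = k := rfl
  omega

end SelPrin

theorem mainTheorem4 (hMA : SelPrin.MartinsAxiom) :
    ∃ X : Set (ℕ → Bool),
      SelPrin.IsStrongGammaSet ↥X ∧
      ¬ SelPrin.Ufin (SelPrin.GammaCovers ↥(X \ SelPrin.FinSets))
          (SelPrin.OpenCovers ↥(X \ SelPrin.FinSets)) ∧
      ¬ SelPrin.IsTauSet ↥(X \ SelPrin.FinSets) := by
  obtain ⟨Y, hinf, hchain, hsparse, hcov⟩ := hMA.exists_tower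
  have hY : (Y ∪ SelPrin.FinSets) \ SelPrin.FinSets = Y :=
    Set.union_sdiff_cancel_right fun x hx => hinf x hx.1 hx.2
  refine ⟨Y ∪ SelPrin.FinSets, SelPrin.isStrongGammaSet_of_clopen hcov, ?_, ?_⟩ <;> rw [hY]
  · exact SelPrin.not_ufin_of_sparse hinf hsparse
  · exact SelPrin.not_isTauSet_of_sparse hinf hchain hsparse
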